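/- Let $M$ be a smooth $3$-manifold (Hausdorff, second countable, possibly with boundary) and let $g$ be a $C^0$ Riemannian metric on $M$, i.e. a continuous, symmetric, positive-definite covariant $2$-tensor. Assume that $(M,g)$ is $C^0$ asymptotically flat: there are a compact set $K\subset M$, a closed ball $B\subset\mathbb R^3$ and a diffeomorphism $M\setminus K\to\mathbb R^3\setminus B$ in whose coordinates $x=(x^1,x^2,x^3)$ one has $g_{ij}=\delta_{ij}+O(|x|^{-q})$ as $|x|\to\infty$, for some $q>0$. For a compact set $K\subset M$ let $|K|$ be its volume with respect to $g$ and let $|\partial^*K|\in[0,\infty]$ be its perimeter with respect to $g$, i.e. the supremum of $\int_K \operatorname{div}_g X\,dV_g$ over the continuous vector fields $X$ with compact support in the interior of $M$, with $|X|_g\le 1$, whose distributional divergence $\operatorname{div}_g X$ is a continuous function. An exhaustion of $M$ is a sequence of compact sets $K_j$ with $K_j\subset \operatorname{int}K_{j+1}$ and $\bigcup_j K_j=M$. Huisken's isoperimetric mass of $(M,g)$ is $$m_{iso}(M,g)=\sup_{\{K_j\}}\ \limsup_{j\to\infty}\ \frac{2}{|\partial^*K_j|}\left[|K_j|-\frac{1}{6\sqrt\pi}\,|\partial^*K_j|^{3/2}\right]\in[-\infty,\infty],$$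 the supremum being taken over all exhaustions $\{K_j\}$ of $M$ by compact sets. Then $$m_{iso}(M,g)=2\,\sup_{\{K_j\}}\ \limsup_{j\to\infty}\left[\left(\frac{3|K_j|}{4\pi}\right)^{1/3}-\left(\frac{|\partial^*K_j|}{4\pi}\right)^{1/2}\right],$$ with the supremum over the same exhaustions. (In both formulas the bracketed expression, with its prefactor, is read as $-\infty$ when $|\partial^*K_j|=\infty$.) -/

import Mathlib

open Set Filter Topology MeasureTheory Manifold Bundle
open scoped ContDiff ENNReal

namespace IsoMass

/-- Euclidean three-space. -/
abbrev E3 : Type := EuclideanSpace ℝ (Fin 3)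

noncomputable section

section Manifold

variable {H : Type*} [TopologicalSpace H] {I : ModelWithCorners ℝ E3 H}
  {M : Type*} [TopologicalSpace M] [ChartedSpace H M] [IsManifold I ∞ M]

variable (I M) in
/-- A `C⁰` Riemannian metric on the smooth 3-manifold `M`: a continuous, symmetric,
positive-definite covariant 2-tensor. -/
abbrev C0Metric : Type _ :=
  ContinuousRiemannianMetric E3 (fun x : M => TangentSpace I x)

variable (I) in
/-- Smooth coordinates `x = (x¹, x², x³)` on an open subset of `M`: a diffeomorphism `φ` from the
open set `φ.source` of `M` onto the open set `φ.target` of `ℝ³`. (The source then automatically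
lies in the interior of `M`, and such charts cover the interior.) -/
def IsCoordinateChart (φ : OpenPartialHomeomorph M E3) : Prop :=
  ContMDiffOn I 𝓘(ℝ, E3) ∞ φ φ.source ∧ ContMDiffOn 𝓘(ℝ, E3) I ∞ φ.symm φ.target

/-- The coordinate vector field `∂ᵢ` of the coordinates `φ`, at the point with coordinates `x`. -/
def coordVector (I : ModelWithCorners ℝ E3 H) (φ : OpenPartialHomeomorph M E3) (x : E3)
    (i : Fin 3) : TangentSpace I (φ.symm x) :=
  mfderiv 𝓘(ℝ, E3) I φ.symm x (EuclideanSpace.single i (1 : ℝ) : E3)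

/-- The matrix `(g_ij)` of the metric in the coordinates `φ`, as a function of the coordinates. -/
def metricCoeff (g : C0Metric I M) (φ : OpenPartialHomeomorph M E3) (x : E3) :
    Matrix (Fin 3) (Fin 3) ℝ :=
  Matrix.of fun i j => g.inner (φ.symm x) (coordVector I φ x i) (coordVector I φ x j)

/-- `(M, g)` is `C⁰` asymptotically flat: the complement of some compact set `K` carries smooth
coordinates with values in the complement of a closed ball of `ℝ³`, in which
`g_ij = δ_ij + O(|x|^{-q})` as `|x| → ∞`, for some `q > 0`. -/
def IsC0AsymptoticallyFlat (g : C0Metric I M) : Prop :=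
  ∃ (K : Set M) (φ : OpenPartialHomeomorph M E3) (c : E3) (R q : ℝ),
    IsCompact K ∧ 0 < R ∧ 0 < q ∧ IsCoordinateChart I φ ∧
    φ.source = Kᶜ ∧ φ.target = (Metric.closedBall c R)ᶜ ∧
    ∀ i j : Fin 3,
      (fun x : E3 => metricCoeff g φ x i j - (1 : Matrix (Fin 3) (Fin 3) ℝ) i j)
        =O[Bornology.cobounded E3] fun x : E3 => ‖x‖ ^ (-q)

variable [MeasurableSpace M] [BorelSpace M]

/-- The measure `√(det g_ij) dx¹ dx² dx³` on the domain of the coordinates `φ`, as a measure on `M`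
(zero outside that domain). -/
def chartVolume (g : C0Metric I M) (φ : OpenPartialHomeomorph M E3) : Measure M :=
  Measure.map φ.symm ((volume.restrict φ.target).withDensity
    fun x => ENNReal.ofReal (Real.sqrt (metricCoeff g φ x).det))

/-- The Riemannian volume measure `dV_g`. The measures `√(det g_ij) dx` of any two charts agree on
the overlap of their domains, so their supremum in the lattice of measures is the measure obtained
by gluing them; it does not charge the boundary of `M`. -/
def volumeMeasure (g : C0Metric I M) : Measure M :=
  ⨆ φ : {φ : OpenPartialHomeomorph M E3 // IsCoordinateChart I φ}, chartVolume g φ.1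

/-- The function `f` is the `g`-divergence of the vector field `X`, in the sense of distributions:
`∫ dη(X) dV_g = - ∫ η f dV_g` for all smooth compactly supported functions `η`. -/
def IsWeakDivergence (g : C0Metric I M) (X : (x : M) → TangentSpace I x) (f : M → ℝ) : Prop :=
  ∀ η : M → ℝ, ContMDiff I 𝓘(ℝ, ℝ) ∞ η → HasCompactSupport η →
    ∫ x, (mfderiv I 𝓘(ℝ, ℝ) η x (X x) : ℝ) ∂(volumeMeasure g) =
      - ∫ x, η x * f x ∂(volumeMeasure g)

/-- Admissible pairs `(X, div_g X)` in the variational definition of perimeter: `X` is a continuous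
vector field with compact support in the interior of `M` and `|X|_g ≤ 1`, and its distributional
divergence is the continuous function `f`. (As `g` is only continuous, a smooth `X` need not have a
divergence that is a function; the density `√(det g_ij) X` is what can be taken smooth. By
mollifying these densities, the supremum below is the same as over the fields for which they are
smooth; when `g` is smooth it is thus the usual one over smooth `X`.) -/
structure IsPerimeterTest (g : C0Metric I M) (X : (x : M) → TangentSpace I x) (f : M → ℝ) :
    Prop where
  continuous_field : Continuous fun x : M => (⟨x, X x⟩ : TangentBundle I M)
  compact_support : ∃ C : Set M, IsCompact C ∧ C ⊆ I.interior M ∧ ∀ x, x ∉ C → X x = 0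
  norm_le_one : ∀ x, g.inner x (X x) (X x) ≤ 1
  continuous_div : Continuous f
  weak_div : IsWeakDivergence g X f

/-- The perimeter `|∂*K|_g = sup ∫_K div_g X dV_g ∈ [0, ∞]` of a Borel set `K`. -/
def perimeter (g : C0Metric I M) (K : Set M) : ℝ≥0∞ :=
  ⨆ (X : (x : M) → TangentSpace I x) (f : M → ℝ) (_ : IsPerimeterTest g X f),
    ENNReal.ofReal (∫ x in K, f x ∂(volumeMeasure g))

/-- The quasi-local quantity `2/|∂*K| (|K| - |∂*K|^{3/2} / (6√π))`, with value `-∞` when `K` has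
infinite perimeter. -/
def isoperimetricDeficit (g : C0Metric I M) (K : Set M) : EReal :=
  open Classical in
  if perimeter g K = ⊤ then ⊥
  else
    ((2 / (perimeter g K).toReal * ((volumeMeasure g K).toReal
      - 1 / (6 * Real.sqrt Real.pi) * (perimeter g K).toReal ^ (3 / 2 : ℝ)) : ℝ) : EReal)

/-- The difference `(3|K|/4π)^{1/3} - (|∂*K|/4π)^{1/2}` of volume radius and area radius, with
value `-∞` when `K` has infinite perimeter. -/
def radiusDifference (g : C0Metric I M) (K : Set M) : EReal :=
  open Classical in
  if perimeter g K = ⊤ then ⊥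
  else
    (((3 * (volumeMeasure g K).toReal / (4 * Real.pi)) ^ (1 / 3 : ℝ)
      - ((perimeter g K).toReal / (4 * Real.pi)) ^ (1 / 2 : ℝ) : ℝ) : EReal)

/-- Huisken's isoperimetric mass `m_iso(M, g) ∈ [-∞, ∞]`, a supremum over all exhaustions of `M` by
compact sets. -/
def isoperimetricMass (g : C0Metric I M) : EReal :=
  ⨆ K : CompactExhaustion M, limsup (fun j : ℕ => isoperimetricDeficit g (K j)) atTop

end Manifold

end

end IsoMass

namespace IsoMass

/-! The equality holds for each exhaustion separately. Let `r` be the volume radius and `s` the area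
radius of `K j`. The deficit becomes `2/3 * (r^3 - s^3) / s^2`, and it exceeds `2 * (r - s)` by `2/3
* (r - s)^2 * (r + 2 * s) / s^2 ≥ 0`, which gives one inequality between the limsups. Conversely,
suppose `r → ∞` and the deficit stays above some real `c`. Then `s - r` is bounded above, since the
deficit is at most `2/3 * (r - s)` when `r ≤ s`. If `r - s` is also bounded above, then `s → ∞`, the
excess is `O(1/s)` and disappears in the limit; this is `exists_lt_two_mul_sub_of_le_deficit`.

The geometric input, `eventually_perimeter_ne_zero_and_tendsto`, is that `|K j|` is finite and tends
to infinity and that the perimeter is eventually nonzero. Volumes of compact sets are finite because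
`volumeMeasure g` is locally finite, including at boundary points; the total volume is infinite
because `√det g_ij → 1` on the end. If `K j` had perimeter zero, its indicator would have zero
distributional gradient on the end. The end is connected, so the indicator would be a.e. constant
far out, and finite volume would force that constant to be 0. This fails once `K j` covers a
non-null part of the far region. -/

/-! ### Comparison of the two quantities as functions of the radii -/

theorem deficit_eq_of_radii {V A r s : ℝ} (hs : 0 < s)
    (hV : V = 4 * Real.pi / 3 * r ^ 3) (hA : A = 4 * Real.pi * s ^ 2) :
    2 / A * (V - 1 / (6 * Real.sqrt Real.pi) * A ^ (3 / 2 : ℝ)) =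
      2 / 3 * ((r ^ 3 - s ^ 3) / s ^ 2) := by
  have hpi := Real.pi_pos
  have hsq : 0 < Real.sqrt Real.pi := Real.sqrt_pos.2 hpi
  have hpow : A ^ (3 / 2 : ℝ) = 8 * Real.pi * Real.sqrt Real.pi * s ^ 3 := by
    have h1 : A = (2 * Real.sqrt Real.pi * s) ^ 2 := by
      rw [hA, mul_pow, mul_pow, Real.sq_sqrt hpi.le]; ring
    rw [h1, ← Real.rpow_natCast, ← Real.rpow_mul (by positivity)]
    norm_num
    norm_cast
    rw [mul_pow, mul_pow, pow_succ (Real.sqrt Real.pi), Real.sq_sqrt hpi.le]; ring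
  rw [hpow, hV, hA]
  field_simp
  ring

theorem two_mul_sub_le_deficit {r s : ℝ} (hr : 0 ≤ r) (hs : 0 < s) :
    2 * (r - s) ≤ 2 / 3 * ((r ^ 3 - s ^ 3) / s ^ 2) := by
  have h : 2 / 3 * ((r ^ 3 - s ^ 3) / s ^ 2) - 2 * (r - s) =
      2 / 3 * ((r - s) ^ 2 * (r + 2 * s) / s ^ 2) := by
    field_simp; ring
  have : 0 ≤ 2 / 3 * ((r - s) ^ 2 * (r + 2 * s) / s ^ 2) := by positivity
  linarith

theorem exists_lt_two_mul_sub_of_le_deficit {c c' : ℝ} (h : c' < c) :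
    ∃ N : ℝ, ∀ r s : ℝ, N ≤ r → 0 < s → c ≤ 2 / 3 * ((r ^ 3 - s ^ 3) / s ^ 2) →
      c' < 2 * (r - s) := by
  -- `L` separates two regimes of `u = r - s`: for `u < -L` the deficit is below `-2 * L / 3 < c`,
  -- and a failure of the conclusion gives `u ≤ c' / 2 ≤ L`.
  set L : ℝ := 3 / 2 * |c| + |c'| + 1 with hL
  have hc := abs_nonneg c
  have hc' := abs_nonneg c'
  have hL1 : 1 ≤ L := by linarith
  -- With `u ≤ L` this leaves `s ≥ 3 * L + 4 * L ^ 2 / (c - c')`: the first term gives `r + 2 * s ≤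
  -- 4 * s`, the second makes the excess smaller than `c - c'`.
  refine ⟨4 * L + 4 * L ^ 2 / (c - c'), fun r s hr hs hd => ?_⟩
  by_contra! hcon
  have hcc : 0 < c - c' := by linarith
  set u := r - s with hu
  have hr' : r = s + u := by rw [hu]; ring
  have huL : u ≤ L := by
    have := le_abs_self c'
    linarith
  have hfrac : 0 < 4 * L ^ 2 / (c - c') := by positivity
  have hrpos : 0 < r := by linarith
  have hsL : 3 * L + 4 * L ^ 2 / (c - c') ≤ s := by linarith
  have hform : 2 / 3 * ((r ^ 3 - s ^ 3) / s ^ 2) =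
      2 * u + 2 / 3 * (u ^ 2 * (r + 2 * s) / s ^ 2) := by
    rw [hr']; field_simp; ring
  rcases le_or_gt (-L) u with hlow | hlow
  · have hu2 : u ^ 2 ≤ L ^ 2 := sq_le_sq' hlow huL
    have hsq : u ^ 2 * (r + 2 * s) / s ^ 2 ≤ L ^ 2 * 4 / s := by
      rw [div_le_div_iff₀ (by positivity) hs]
      have h1 : r + 2 * s ≤ 4 * s := by linarith
      have h2 : u ^ 2 * (r + 2 * s) ≤ L ^ 2 * (4 * s) := by gcongr
      nlinarith
    have h3 : 4 * L ^ 2 / s < c - c' := by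
      rw [div_lt_iff₀ hs]
      have : 4 * L ^ 2 / (c - c') < s := by linarith
      rw [div_lt_iff₀ hcc] at this
      linarith
    have : 2 / 3 * (u ^ 2 * (r + 2 * s) / s ^ 2) ≤ 4 * L ^ 2 / s := by
      have h4 : L ^ 2 * 4 / s = 4 * L ^ 2 / s := by ring
      have h5 : 0 ≤ 4 * L ^ 2 / s := by positivity
      linarith
    linarith
  · have hneg : (r ^ 3 - s ^ 3) / s ^ 2 ≤ u := by
      rw [div_le_iff₀ (by positivity)]
      have : r ^ 3 - s ^ 3 - u * s ^ 2 = u * (r ^ 2 + r * s) := by rw [hr']; ring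
      have h2 : u * (r ^ 2 + r * s) ≤ 0 :=
        mul_nonpos_of_nonpos_of_nonneg (by linarith) (by positivity)
      linarith
    have := neg_abs_le c
    linarith

theorem two_ne_top : (2 : EReal) ≠ ⊤ := by
  exact_mod_cast EReal.coe_ne_top 2

theorem two_mul_iSup {ι : Sort*} (u : ι → EReal) : 2 * ⨆ i, u i = ⨆ i, 2 * u i := by
  refine Monotone.map_iSup_of_continuousAt (f := fun x : EReal => 2 * x) ?_
    (fun a b hab => mul_le_mul_of_nonneg_left hab (by norm_num))
    (EReal.mul_bot_of_pos (by norm_num))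
  have : (2 : EReal) ≠ ⊥ := by exact_mod_cast EReal.coe_ne_bot 2
  exact (EReal.continuousAt_mul (p := (2, ⨆ i, u i)) (Or.inl two_ne_zero) (Or.inl two_ne_zero)
    (Or.inl this) (Or.inl two_ne_top)).comp (f := fun x : EReal => ((2 : EReal), x))
      (Continuous.prodMk_right 2).continuousAt

/-- The hypothesis `hP` is essential: where `P j = 0`, division by zero makes the deficit `0`,
whereas the radius difference is the full volume radius. Where `P j = ⊤`, both sides are `⊥`. -/
theorem limsup_deficit_eq_two_mul_limsup {V : ℕ → ℝ} {P : ℕ → ℝ≥0∞}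
    (hV : Tendsto V atTop atTop) (hP : ∀ᶠ j in atTop, P j ≠ 0) :
    limsup (fun j => open Classical in if P j = ⊤ then (⊥ : EReal) else
      ((2 / (P j).toReal * (V j - 1 / (6 * Real.sqrt Real.pi) * (P j).toReal ^ (3 / 2 : ℝ)) :
        ℝ) : EReal)) atTop =
    2 * limsup (fun j => open Classical in if P j = ⊤ then (⊥ : EReal) else
      (((3 * V j / (4 * Real.pi)) ^ (1 / 3 : ℝ) - ((P j).toReal / (4 * Real.pi)) ^ (1 / 2 : ℝ) :
        ℝ) : EReal)) atTop := by
  have hpi := Real.pi_pos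
  set r : ℕ → ℝ := fun j => (3 * V j / (4 * Real.pi)) ^ (1 / 3 : ℝ) with hr
  set s : ℕ → ℝ := fun j => ((P j).toReal / (4 * Real.pi)) ^ (1 / 2 : ℝ) with hs
  have hrt : Tendsto r atTop atTop :=
    (tendsto_rpow_atTop (by norm_num)).comp
      ((hV.const_mul_atTop three_pos).atTop_div_const (by positivity))
  have key : ∀ᶠ j in atTop, P j ≠ ⊤ → 0 < s j ∧ 2 / (P j).toReal *
      (V j - 1 / (6 * Real.sqrt Real.pi) * (P j).toReal ^ (3 / 2 : ℝ)) =
        2 / 3 * ((r j ^ 3 - s j ^ 3) / s j ^ 2) := by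
    filter_upwards [hP, hV.eventually_ge_atTop 0] with j hj hVj htop
    have hA : 0 < (P j).toReal := ENNReal.toReal_pos hj htop
    have hsj : 0 < s j := Real.rpow_pos_of_pos (by positivity) _
    refine ⟨hsj, deficit_eq_of_radii hsj ?_ ?_⟩
    · have : r j ^ 3 = 3 * V j / (4 * Real.pi) := by
        simp only [hr]
        rw [← Real.rpow_natCast, ← Real.rpow_mul (by positivity)]; norm_num
      rw [this]; field_simp
    · have : s j ^ 2 = (P j).toReal / (4 * Real.pi) := by
        simp only [hs]
        rw [← Real.rpow_natCast, ← Real.rpow_mul (by positivity)]; norm_num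
      rw [this]; field_simp
  have hmul : ∀ u : ℕ → EReal, 2 * limsup u atTop = limsup (fun j => 2 * u j) atTop := fun u =>
    (EReal.limsup_const_mul_of_nonneg_of_ne_top (by norm_num) two_ne_top).symm
  rw [hmul]
  apply le_antisymm
  · by_contra! hlt
    -- Two reals `c' < c` strictly between the limsups: the deficit exceeds `c` infinitely often,
    -- while twice the radius difference is eventually below `c'`.
    obtain ⟨c', hc'1, hc'2⟩ := EReal.lt_iff_exists_real_btwn.1 hlt
    obtain ⟨c, hc1, hc2⟩ := EReal.lt_iff_exists_real_btwn.1 hc'2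
    obtain ⟨N, hN⟩ := exists_lt_two_mul_sub_of_le_deficit (EReal.coe_lt_coe_iff.1 hc1)
    have hev := eventually_lt_of_limsup_lt hc'1
    have hfr := frequently_lt_of_lt_limsup (h := hc2)
    obtain ⟨j, hj1, hj2, hj3, hj4⟩ :=
      (hfr.and_eventually (hev.and (key.and (hrt.eventually_ge_atTop N)))).exists
    by_cases htop : P j = ⊤
    · simp [htop] at hj1
    · obtain ⟨hsj, hd⟩ := hj3 htop
      rw [if_neg htop, hd, EReal.coe_lt_coe_iff] at hj1
      rw [if_neg htop] at hj2
      have h2 : 2 * (r j - s j) < c' := by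
        rw [← EReal.coe_lt_coe_iff, EReal.coe_mul]; exact hj2
      exact absurd (hN _ _ hj4 hsj hj1.le) (not_lt.2 h2.le)
  · refine limsup_le_limsup ?_
    filter_upwards [key, hrt.eventually_ge_atTop 0] with j hj hrj
    by_cases htop : P j = ⊤
    · simp [htop, EReal.mul_bot_of_pos]
    · obtain ⟨hsj, hd⟩ := hj htop
      rw [if_neg htop, if_neg htop, hd]
      refine le_trans (le_of_eq ?_) (EReal.coe_le_coe_iff.2 (two_mul_sub_le_deficit hrj hsj))
      rw [EReal.coe_mul]; rfl

/-! ### Coordinate charts and the Gram determinant of the metric -/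

section

variable {H : Type*} [TopologicalSpace H] {I : ModelWithCorners ℝ E3 H}
  {M : Type*} [TopologicalSpace M] [ChartedSpace H M]

/-- The derivative of the parametrization `φ.symm` at `x`, with the tangent space of `M` identified
with the model space. -/
noncomputable def symmDeriv (I : ModelWithCorners ℝ E3 H) (φ : OpenPartialHomeomorph M E3)
    (x : E3) : E3 →L[ℝ] E3 :=
  mfderiv 𝓘(ℝ, E3) I φ.symm x

/-- The derivative of a map `f : M → E3` at `p`, with the tangent space of `M` identified with the
model space. -/
noncomputable def modelDeriv (I : ModelWithCorners ℝ E3 H) (f : M → E3) (p : M) : E3 →L[ℝ] E3 :=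
  mfderiv I 𝓘(ℝ, E3) f p

theorem IsCoordinateChart.mdifferentiableAt {φ : OpenPartialHomeomorph M E3}
    (hφ : IsCoordinateChart I φ) {p : M} (hp : p ∈ φ.source) :
    MDifferentiableAt I 𝓘(ℝ, E3) φ p :=
  (hφ.1.contMDiffAt (φ.open_source.mem_nhds hp)).mdifferentiableAt (by simp)

theorem IsCoordinateChart.mdifferentiableAt_symm {φ : OpenPartialHomeomorph M E3}
    (hφ : IsCoordinateChart I φ) {x : E3} (hx : x ∈ φ.target) :
    MDifferentiableAt 𝓘(ℝ, E3) I φ.symm x :=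
  (hφ.2.contMDiffAt (φ.open_target.mem_nhds hx)).mdifferentiableAt (by simp)

theorem IsCoordinateChart.fderiv_comp_symm [IsManifold I ∞ M] {φ : OpenPartialHomeomorph M E3}
    (hφ : IsCoordinateChart I φ) {x : E3} (hx : x ∈ φ.target) {f : M → E3}
    (hf : MDifferentiableAt I 𝓘(ℝ, E3) f (φ.symm x)) :
    HasFDerivAt (f ∘ φ.symm)
      ((modelDeriv I f (φ.symm x)).comp (symmDeriv I φ x)) x := by
  have h := (hf.hasMFDerivAt).comp x (hφ.mdifferentiableAt_symm hx).hasMFDerivAt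
  exact h.hasFDerivAt

theorem IsCoordinateChart.mfderiv_comp_symmDeriv [IsManifold I ∞ M]
    {φ : OpenPartialHomeomorph M E3}
    (hφ : IsCoordinateChart I φ) {x : E3} (hx : x ∈ φ.target) :
    (modelDeriv I φ (φ.symm x)).comp (symmDeriv I φ x) =
      ContinuousLinearMap.id ℝ E3 := by
  have h := hφ.fderiv_comp_symm hx (hφ.mdifferentiableAt (φ.map_target hx))
  have h2 : HasFDerivAt (φ ∘ φ.symm) (ContinuousLinearMap.id ℝ E3) x := by
    refine (hasFDerivAt_id x).congr_of_eventuallyEq ?_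
    filter_upwards [φ.open_target.mem_nhds hx] with y hy using φ.right_inv hy
  exact h.unique h2

theorem IsCoordinateChart.symmDeriv_injective [IsManifold I ∞ M]
    {φ : OpenPartialHomeomorph M E3}
    (hφ : IsCoordinateChart I φ) {x : E3} (hx : x ∈ φ.target) :
    Function.Injective (symmDeriv I φ x) :=
  Function.LeftInverse.injective
    (g := modelDeriv I φ (φ.symm x)) fun v =>
      congrArg (fun L : E3 →L[ℝ] E3 => L v) (hφ.mfderiv_comp_symmDeriv hx)

/-- The derivative of `φ.symm` is injective between spaces of equal dimension, hence surjective, and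
a map from a boundaryless manifold cannot reach a boundary point with surjective derivative. -/
theorem IsCoordinateChart.source_subset_interior [IsManifold I ∞ M]
    {φ : OpenPartialHomeomorph M E3}
    (hφ : IsCoordinateChart I φ) : φ.source ⊆ I.interior M := by
  intro p hp
  have hx := φ.map_source hp
  have hs : Function.Surjective (symmDeriv I φ (φ p)) :=
    (LinearMap.injective_iff_surjective (f := (symmDeriv I φ (φ p)).toLinearMap)).1
      (hφ.symmDeriv_injective hx)
  have := (hφ.mdifferentiableAt_symm hx).isInteriorPoint_of_surjective_mfderiv hs
    BoundarylessManifold.isInteriorPoint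
  rwa [φ.left_inv hp] at this

/-- The Gram matrix transforms by congruence, `Aᵀ * G * A` with `A` the matrix of `T`. -/
theorem det_bilin_comp (B : E3 →L[ℝ] E3 →L[ℝ] ℝ) (T : E3 →L[ℝ] E3) :
    (Matrix.of fun i j : Fin 3 => B (T (EuclideanSpace.single i 1))
      (T (EuclideanSpace.single j 1))).det =
    T.det ^ 2 * (Matrix.of fun i j : Fin 3 => B (EuclideanSpace.single i 1)
      (EuclideanSpace.single j 1)).det := by
  set b := (EuclideanSpace.basisFun (Fin 3) ℝ).toBasis with hb
  have hbi : ∀ i, b i = EuclideanSpace.single i 1 := fun i => by simp [hb]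
  set A := LinearMap.toMatrix b b T.toLinearMap with hA
  have hT : ∀ i, T (EuclideanSpace.single i 1) = ∑ k, A k i • EuclideanSpace.single k (1 : ℝ) := by
    intro i
    have := b.sum_repr (T (b i))
    rw [hbi] at this
    rw [← this]
    refine Finset.sum_congr rfl fun k _ => ?_
    rw [hbi, hA, LinearMap.toMatrix_apply, hbi]; rfl
  have hmat : (Matrix.of fun i j : Fin 3 => B (T (EuclideanSpace.single i 1))
      (T (EuclideanSpace.single j 1))) = A.transpose * (Matrix.of fun i j : Fin 3 =>
        B (EuclideanSpace.single i 1) (EuclideanSpace.single j 1)) * A := by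
    ext i j
    simp only [Matrix.of_apply, hT, map_sum, map_smul, sum_apply,
      smul_apply, Matrix.mul_apply, Matrix.transpose_apply, smul_eq_mul,
      Finset.mul_sum, Finset.sum_mul]
    refine Finset.sum_congr rfl fun k _ => Finset.sum_congr rfl fun l _ => ?_
    ring
  have hdet : T.det = A.det := (LinearMap.det_toMatrix b T.toLinearMap).symm
  rw [hmat, Matrix.det_mul, Matrix.det_mul, Matrix.det_transpose, hdet]; ring

variable [IsManifold I ∞ M]

/-- The metric at a point, as a bilinear form on the model space. -/
def C0Metric.form (g : C0Metric I M) (p : M) : E3 →L[ℝ] E3 →L[ℝ] ℝ := g.inner p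

theorem metricCoeff_apply (g : C0Metric I M) (φ : OpenPartialHomeomorph M E3) (x : E3)
    (i j : Fin 3) : metricCoeff g φ x i j = g.form (φ.symm x)
      (symmDeriv I φ x (EuclideanSpace.single i 1)) (symmDeriv I φ x (EuclideanSpace.single j 1)) :=
  rfl

/-- The metric in coordinates, as a bilinear form. -/
noncomputable def pullbackForm (g : C0Metric I M) (φ : OpenPartialHomeomorph M E3) (x : E3) :
    E3 →L[ℝ] E3 →L[ℝ] ℝ :=
  (g.form (φ.symm x)).bilinearComp (symmDeriv I φ x) (symmDeriv I φ x)

theorem metricCoeff_eq_pullbackForm (g : C0Metric I M) (φ : OpenPartialHomeomorph M E3) (x : E3) :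
    metricCoeff g φ x = Matrix.of fun i j : Fin 3 => pullbackForm g φ x
      (EuclideanSpace.single i 1) (EuclideanSpace.single j 1) :=
  rfl

theorem det_metricCoeff_pos (g : C0Metric I M) {φ : OpenPartialHomeomorph M E3}
    (hφ : IsCoordinateChart I φ) {x : E3} (hx : x ∈ φ.target) : 0 < (metricCoeff g φ x).det := by
  refine Matrix.PosDef.det_pos (.of_dotProduct_mulVec_pos ?_ fun v hv => ?_)
  · ext i j
    simp only [Matrix.conjTranspose_apply, star_trivial, metricCoeff_apply]
    exact g.symm _ _ _
  · set w : E3 := WithLp.toLp 2 v with hw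
    have hw0 : symmDeriv I φ x w ≠ 0 := by
      rw [Ne, map_eq_zero_iff _ (hφ.symmDeriv_injective hx)]
      simpa [hw] using hv
    have hpos : 0 < g.form (φ.symm x) (symmDeriv I φ x w) (symmDeriv I φ x w) := g.pos _ _ hw0
    have hsum : w = ∑ i, v i • EuclideanSpace.single i (1 : ℝ) := by
      ext k; simp [hw, Fin.sum_univ_three]; fin_cases k <;> simp
    convert! hpos using 1
    rw [hsum]
    simp only [map_sum, map_smul, sum_apply,
      smul_apply, dotProduct, Matrix.mulVec, metricCoeff_apply, smul_eq_mul,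
      Finset.mul_sum, star_trivial, Pi.star_apply]
    rw [Finset.sum_comm]
    refine Finset.sum_congr rfl fun k _ => Finset.sum_congr rfl fun l _ => ?_
    ring

/-- Near `x`, `φ'.symm` factors as `φ.symm` after the transition map; the chain rule and
`det_bilin_comp` then give the square of the Jacobian. -/
theorem det_metricCoeff_change (g : C0Metric I M) {φ φ' : OpenPartialHomeomorph M E3}
    (hφ : IsCoordinateChart I φ) (hφ' : IsCoordinateChart I φ') {x : E3} (hx : x ∈ φ'.target)
    (hx' : φ'.symm x ∈ φ.source) :
    (metricCoeff g φ' x).det =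
      (fderiv ℝ (φ ∘ φ'.symm) x).det ^ 2 * (metricCoeff g φ (φ (φ'.symm x))).det := by
  have hF := hφ'.fderiv_comp_symm hx (hφ.mdifferentiableAt hx')
  have hmf : symmDeriv I φ' x =
      (symmDeriv I φ (φ (φ'.symm x))).comp (fderiv ℝ (φ ∘ φ'.symm) x) := by
    have h1 : HasMFDerivAt 𝓘(ℝ, E3) 𝓘(ℝ, E3) (φ ∘ φ'.symm) x (fderiv ℝ (φ ∘ φ'.symm) x) :=
      hF.differentiableAt.hasFDerivAt.hasMFDerivAt
    have h2 := HasMFDerivAt.comp x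
      (hφ.mdifferentiableAt_symm (φ.map_source hx')).hasMFDerivAt h1
    have h3 : φ'.symm =ᶠ[𝓝 x] φ.symm ∘ (φ ∘ φ'.symm) := by
      have : ∀ᶠ y in 𝓝 x, φ'.symm y ∈ φ.source :=
        (φ'.continuousAt_symm hx).eventually (φ.open_source.mem_nhds hx')
      filter_upwards [this] with y hy using (φ.left_inv hy).symm
    exact (h2.congr_of_eventuallyEq h3).mfderiv
  have := det_bilin_comp (pullbackForm g φ (φ (φ'.symm x))) (fderiv ℝ (φ ∘ φ'.symm) x)
  rw [metricCoeff_eq_pullbackForm g φ, ← this]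
  congr 1
  ext i j
  simp only [metricCoeff_apply, Matrix.of_apply, hmf, pullbackForm,
    ContinuousLinearMap.bilinearComp_apply, φ.left_inv hx', ContinuousLinearMap.comp_apply]

end

/-! ### The volume measure: agreement of charts and local finiteness -/

section

variable {H : Type*} [TopologicalSpace H] {I : ModelWithCorners ℝ E3 H}
  {M : Type*} [TopologicalSpace M] [ChartedSpace H M]

/-- A supremum of measures is not computed set by set. Instead, `ν` plus the part of the supremum on
`Nᶜ` is an upper bound of the family, and restriction to `N` removes the second term. -/
theorem restrict_iSup_le {α ι : Type*} [MeasurableSpace α] {m : ι → Measure α} {ν : Measure α}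
    {N : Set α} (hN : MeasurableSet N) (h : ∀ i, (m i).restrict N ≤ ν) :
    (⨆ i, m i).restrict N ≤ ν := by
  have hle : (⨆ i, m i) ≤ ν + (⨆ i, m i).restrict Nᶜ := by
    refine iSup_le fun i => ?_
    calc m i = (m i).restrict N + (m i).restrict Nᶜ := (Measure.restrict_add_restrict_compl hN).symm
      _ ≤ ν + (⨆ i, m i).restrict Nᶜ :=
        add_le_add (h i) (Measure.restrict_mono_measure (le_iSup m i) _)
  calc (⨆ i, m i).restrict N ≤ (ν + (⨆ i, m i).restrict Nᶜ).restrict N :=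
        Measure.restrict_mono_measure hle _
    _ = ν.restrict N := by
        rw [Measure.restrict_add, Measure.restrict_restrict hN]; simp
    _ ≤ ν := Measure.restrict_le_self

theorem measurableSet_inter_preimage {X Y : Type*} [TopologicalSpace X] [MeasurableSpace X]
    [OpensMeasurableSpace X] [TopologicalSpace Y] [MeasurableSpace Y] [BorelSpace Y]
    {f : X → Y} {s : Set X} {t : Set Y} (hf : ContinuousOn f s) (hs : MeasurableSet s)
    (ht : MeasurableSet t) : MeasurableSet (s ∩ f ⁻¹' t) := by
  have h := hs.subtype_image ((continuousOn_iff_continuous_domRestrict.1 hf).measurable ht)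
  convert h using 1
  ext x; simp [and_comm]

variable [IsManifold I ∞ M] [MeasurableSpace M] [BorelSpace M]

theorem chartVolume_apply (g : C0Metric I M) (φ : OpenPartialHomeomorph M E3) {A : Set M}
    (hA : MeasurableSet A) : chartVolume g φ A =
      ∫⁻ x in φ.target ∩ φ.symm ⁻¹' A, ENNReal.ofReal (Real.sqrt (metricCoeff g φ x).det) := by
  have hae : AEMeasurable φ.symm (volume.restrict φ.target) :=
    φ.continuousOn_symm.aemeasurable φ.open_target.measurableSet
  rw [chartVolume, Measure.map_apply_of_aemeasurable
    (hae.mono_ac (withDensity_absolutelyContinuous _ _)) hA, withDensity_apply',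
    Measure.restrict_restrict' φ.open_target.measurableSet, inter_comm]

/-- Change of variables along the transition map: its Jacobian is exactly the ratio of the two
densities. -/
theorem chartVolume_restrict_source_le (g : C0Metric I M) {φ φ' : OpenPartialHomeomorph M E3}
    (hφ : IsCoordinateChart I φ) (hφ' : IsCoordinateChart I φ') :
    (chartVolume g φ').restrict φ.source ≤ chartVolume g φ := by
  refine Measure.le_iff.2 fun A hA => ?_
  have hAs := hA.inter φ.open_source.measurableSet
  rw [Measure.restrict_apply hA, chartVolume_apply g φ' hAs, chartVolume_apply g φ hA]
  set S := φ'.target ∩ φ'.symm ⁻¹' (A ∩ φ.source) with hS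
  have hSm : MeasurableSet S :=
    measurableSet_inter_preimage φ'.continuousOn_symm φ'.open_target.measurableSet hAs
  have hinj : InjOn (φ ∘ φ'.symm) S := fun x hx y hy hxy =>
    φ'.symm.injOn hx.1 hy.1 (φ.injOn hx.2.2 hy.2.2 hxy)
  have hder : ∀ x ∈ S, HasFDerivWithinAt (φ ∘ φ'.symm) (fderiv ℝ (φ ∘ φ'.symm) x) S x :=
    fun x hx => (hφ'.fderiv_comp_symm hx.1
      (hφ.mdifferentiableAt hx.2.2)).differentiableAt.hasFDerivAt.hasFDerivWithinAt
  have hcv := lintegral_image_eq_lintegral_abs_det_fderiv_mul volume hSm hder hinj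
    (fun x => ENNReal.ofReal (Real.sqrt (metricCoeff g φ x).det))
  calc ∫⁻ x in S, ENNReal.ofReal (Real.sqrt (metricCoeff g φ' x).det)
      = ∫⁻ x in (φ ∘ φ'.symm) '' S, ENNReal.ofReal (Real.sqrt (metricCoeff g φ x).det) := by
        rw [hcv]
        refine setLIntegral_congr_fun hSm fun x hx => ?_
        simp only [Function.comp_apply]
        rw [det_metricCoeff_change g hφ hφ' hx.1 hx.2.2, Real.sqrt_mul (sq_nonneg _),
          Real.sqrt_sq_eq_abs, ENNReal.ofReal_mul (abs_nonneg _)]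
    _ ≤ _ := by
        refine lintegral_mono_set ?_
        rintro _ ⟨x, hx, rfl⟩
        exact ⟨φ.map_source hx.2.2, by simpa [φ.left_inv hx.2.2] using hx.2.1⟩

theorem volumeMeasure_restrict_source (g : C0Metric I M) {φ : OpenPartialHomeomorph M E3}
    (hφ : IsCoordinateChart I φ) :
    (volumeMeasure g).restrict φ.source = chartVolume g φ := by
  refine le_antisymm (restrict_iSup_le φ.open_source.measurableSet fun ψ =>
    chartVolume_restrict_source_le g hφ ψ.2) ?_
  have hle : chartVolume g φ ≤ volumeMeasure g :=
    le_iSup (fun ψ : {φ : OpenPartialHomeomorph M E3 // IsCoordinateChart I φ} =>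
      chartVolume g ψ.1) ⟨φ, hφ⟩
  refine Measure.le_iff.2 fun A hA => ?_
  rw [Measure.restrict_apply hA]
  refine le_trans (le_of_eq ?_) (hle _)
  rw [chartVolume_apply g φ hA, chartVolume_apply g φ (hA.inter φ.open_source.measurableSet)]
  congr 2
  ext x
  exact ⟨fun h => ⟨h.1, h.2, φ.map_target h.1⟩, fun h => ⟨h.1, h.2.1⟩⟩

omit [MeasurableSpace M] [BorelSpace M] in
-- `T q` is the inverse trivialization of the tangent bundle based at `p`, whose operator norm with
-- respect to `g` is bounded near `p`. The point `p` may lie on the boundary, where no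
-- `IsCoordinateChart` is available.
theorem exists_bounded_frame (g : C0Metric I M) (p : M) :
    ∃ (C : ℝ) (T : M → E3 →L[ℝ] E3), ∀ᶠ q in 𝓝 p,
      (∀ i j : Fin 3, |g.form q (T q (EuclideanSpace.single i 1))
        (T q (EuclideanSpace.single j 1))| ≤ C) ∧
      q ∈ (chartAt H p).source ∧ ∀ v, T q (modelDeriv I (extChartAt I p) q v) = v := by
  let : RiemannianBundle (fun x : M => TangentSpace I x) := ⟨g.toRiemannianMetric⟩
  obtain ⟨C, hC, h⟩ :=
    eventually_norm_symmL_trivializationAt_lt E3 (fun x : M => TangentSpace I x) p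
  refine ⟨C * C, fun q => (trivializationAt E3 (TangentSpace I) p).symmL ℝ q, ?_⟩
  filter_upwards [h, chart_source_mem_nhds H p] with q hq hqs
  refine ⟨fun i j => ?_, hqs, fun v => ?_⟩
  · have hb : ∀ i : Fin 3, ‖(trivializationAt E3 (TangentSpace I) p).symmL ℝ q
        (EuclideanSpace.single i 1)‖ ≤ C := fun i =>
      (ContinuousLinearMap.le_of_opNorm_le _ hq.le _).trans (by simp)
    refine (abs_real_inner_le_norm (F := TangentSpace I q) _ _).trans ?_
    exact mul_le_mul (hb i) (hb j) (norm_nonneg _) hC.le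
  · have h1 := TangentBundle.continuousLinearMapAt_trivializationAt (𝕜 := ℝ) (I := I) hqs
    have h2 := (trivializationAt E3 (TangentSpace I) p).symmL_continuousLinearMapAt (R := ℝ)
      (b := q) (by simpa using hqs) v
    rw [h1] at h2
    exact h2

/-- The bound `ν` is a multiple of Lebesgue measure in the extended chart at `p`, on a ball. It has
to serve all charts `φ` at once so that it passes to their supremum. -/
theorem exists_chartVolume_restrict_le (g : C0Metric I M) (p : M) :
    ∃ (N : Set M) (ν : Measure M), IsOpen N ∧ p ∈ N ∧ ν univ < ⊤ ∧
      ∀ φ : OpenPartialHomeomorph M E3, IsCoordinateChart I φ →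
        (chartVolume g φ).restrict N ≤ ν := by
  obtain ⟨C, T, hC⟩ := exists_bounded_frame g p
  set Θ := extChartAt I p with hΘ
  have hΘb : ∀ᶠ q in 𝓝 p, Θ q ∈ Metric.ball (Θ p) 1 :=
    (continuousAt_extChartAt p).eventually (Metric.ball_mem_nhds _ one_pos)
  obtain ⟨N, hN, hNo, hpN⟩ := eventually_nhds_iff.1
    (hC.and hΘb)
  have hTm : MeasurableSet Θ.target := by
    rw [hΘ, extChartAt_target]
    exact ((chartAt H p).open_target.preimage I.continuous_symm).measurableSet.inter
      I.isClosed_range.measurableSet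
  have hTB : MeasurableSet (Θ.target ∩ Metric.ball (Θ p) 1) := hTm.inter measurableSet_ball
  have hcont : ContinuousOn Θ.symm (Θ.target ∩ Metric.ball (Θ p) 1) :=
    (continuousOn_extChartAt_symm p).mono inter_subset_left
  -- A 3×3 determinant with entries at most `C` in absolute value is at most `3! * C ^ 3`.
  set D : ℝ := Real.sqrt ((Nat.factorial 3 : ℝ) * C ^ 3) with hD
  refine ⟨N, (ENNReal.ofReal D) •
    Measure.map Θ.symm (volume.restrict (Θ.target ∩ Metric.ball (Θ p) 1)), hNo, hpN, ?_, ?_⟩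
  · rw [Measure.smul_apply, Measure.map_apply_of_aemeasurable (hcont.aemeasurable hTB)
      MeasurableSet.univ, smul_eq_mul, preimage_univ, Measure.restrict_apply_univ]
    exact ENNReal.mul_lt_top ENNReal.ofReal_lt_top
      ((measure_mono inter_subset_right).trans_lt measure_ball_lt_top)
  · intro φ hφ
    refine Measure.le_iff.2 fun A hA => ?_
    have hAN := hA.inter hNo.measurableSet
    rw [Measure.restrict_apply hA, chartVolume_apply g φ hAN]
    set S := φ.target ∩ φ.symm ⁻¹' (A ∩ N) with hS
    have hSm : MeasurableSet S :=
      measurableSet_inter_preimage φ.continuousOn_symm φ.open_target.measurableSet hAN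
    have hchart : ∀ x ∈ S, φ.symm x ∈ (chartAt H p).source := fun x hx => (hN _ hx.2.2).1.2.1
    have hsrc : ∀ x ∈ S, φ.symm x ∈ Θ.source := fun x hx => by simpa [hΘ] using hchart x hx
    have hinj : InjOn (Θ ∘ φ.symm) S := fun x hx y hy hxy =>
      φ.symm.injOn hx.1 hy.1 (Θ.injOn (hsrc x hx) (hsrc y hy) hxy)
    have hder : ∀ x ∈ S, HasFDerivAt (Θ ∘ φ.symm)
        ((modelDeriv I Θ (φ.symm x)).comp (symmDeriv I φ x)) x :=
      fun x hx => hφ.fderiv_comp_symm hx.1 (mdifferentiableAt_extChartAt (hchart x hx))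
    have hbound : ∀ x ∈ S, Real.sqrt (metricCoeff g φ x).det ≤
        D * |(fderiv ℝ (Θ ∘ φ.symm) x).det| := by
      intro x hx
      have hsy : symmDeriv I φ x = (T (φ.symm x)).comp (fderiv ℝ (Θ ∘ φ.symm) x) := by
        rw [(hder x hx).fderiv]
        ext1 v
        exact ((hN _ hx.2.2).1.2.2 _).symm
      set B := (g.form (φ.symm x)).bilinearComp (T (φ.symm x)) (T (φ.symm x)) with hB
      have hco : metricCoeff g φ x = Matrix.of fun i j : Fin 3 =>
          B (fderiv ℝ (Θ ∘ φ.symm) x (EuclideanSpace.single i 1))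
            (fderiv ℝ (Θ ∘ φ.symm) x (EuclideanSpace.single j 1)) := by
        ext i j
        simp only [metricCoeff_apply, hsy, Matrix.of_apply, hB,
          ContinuousLinearMap.bilinearComp_apply, ContinuousLinearMap.comp_apply]
      rw [hco, det_bilin_comp, Real.sqrt_mul (sq_nonneg _), Real.sqrt_sq_eq_abs, mul_comm]
      refine mul_le_mul_of_nonneg_right (Real.sqrt_le_sqrt ?_) (abs_nonneg _)
      refine (le_abs_self _).trans ?_
      have := Matrix.det_le (abv := AbsoluteValue.abs) (x := C)
        (A := Matrix.of fun i j : Fin 3 => B (EuclideanSpace.single i 1)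
          (EuclideanSpace.single j 1)) (fun i j => (hN _ hx.2.2).1.1 i j)
      simpa using this
    calc ∫⁻ x in S, ENNReal.ofReal (Real.sqrt (metricCoeff g φ x).det)
        ≤ ∫⁻ x in S, ENNReal.ofReal D * ENNReal.ofReal |(fderiv ℝ (Θ ∘ φ.symm) x).det| := by
          refine setLIntegral_mono' hSm fun x hx => ?_
          rw [← ENNReal.ofReal_mul (Real.sqrt_nonneg _)]
          exact ENNReal.ofReal_le_ofReal (hbound x hx)
      _ = ENNReal.ofReal D * volume ((Θ ∘ φ.symm) '' S) := by
          rw [lintegral_const_mul' _ _ ENNReal.ofReal_ne_top,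
            lintegral_abs_det_fderiv_eq_addHaar_image volume hSm
              (fun x hx => (hder x hx).differentiableAt.hasFDerivAt.hasFDerivWithinAt) hinj]
      _ ≤ _ := by
          rw [Measure.smul_apply, Measure.map_apply_of_aemeasurable (hcont.aemeasurable hTB) hA,
            Measure.restrict_apply' hTB, smul_eq_mul]
          gcongr
          rintro _ ⟨x, hx, rfl⟩
          exact ⟨by simpa [Θ.left_inv (hsrc x hx)] using hx.2.1, Θ.map_source (hsrc x hx),
            (hN _ hx.2.2).2⟩

instance isLocallyFiniteMeasure_volumeMeasure (g : C0Metric I M) :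
    IsLocallyFiniteMeasure (volumeMeasure g) := by
  refine ⟨fun p => ?_⟩
  obtain ⟨N, ν, hNo, hpN, hν, h⟩ := exists_chartVolume_restrict_le g p
  refine ⟨N, hNo.mem_nhds hpN, ?_⟩
  have := restrict_iSup_le (m := fun ψ : {φ : OpenPartialHomeomorph M E3 // IsCoordinateChart I φ} =>
    chartVolume g ψ.1) hNo.measurableSet (fun ψ => h ψ.1 ψ.2)
  calc volumeMeasure g N = (volumeMeasure g).restrict N univ := by simp
    _ ≤ ν univ := this univ
    _ < ⊤ := hν

end

/-! ### Test fields supported in a chart -/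

section

variable {H : Type*} [TopologicalSpace H] {I : ModelWithCorners ℝ E3 H}
  {M : Type*} [TopologicalSpace M] [ChartedSpace H M]

theorem IsCoordinateChart.continuousOn_symmDeriv_section [IsManifold I ∞ M]
    {φ : OpenPartialHomeomorph M E3} (hφ : IsCoordinateChart I φ) {c : E3 → E3}
    (hc : ContinuousOn c φ.target) :
    ContinuousOn (fun x => (⟨φ.symm x, symmDeriv I φ x (c x)⟩ : TangentBundle I M)) φ.target := by
  have h1 := hφ.2.continuousOn_tangentMapWithin (by simp) φ.open_target.uniqueMDiffOn
  have h2 : ContinuousOn (fun x => (⟨x, c x⟩ : TangentBundle 𝓘(ℝ, E3) E3)) φ.target := by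
    intro x hx
    rw [FiberBundle.continuousWithinAt_totalSpace]
    refine ⟨continuousWithinAt_id, ?_⟩
    simpa using hc x hx
  refine (h1.comp h2 (fun x hx => hx)).congr fun x hx => ?_
  simp only [Function.comp_apply, tangentMapWithin]
  rw [mfderivWithin_of_isOpen φ.open_target hx]
  rfl

theorem continuousOn_pullbackForm [IsManifold I ∞ M] (g : C0Metric I M)
    {φ : OpenPartialHomeomorph M E3} (hφ : IsCoordinateChart I φ) (u v : E3) :
    ContinuousOn (fun x => pullbackForm g φ x u v) φ.target := by
  let : RiemannianBundle (fun x : M => TangentSpace I x) := ⟨g.toRiemannianMetric⟩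
  exact ContinuousOn.inner_bundle (F := E3) (E := fun x : M => TangentSpace I x) (b := φ.symm)
    (v := fun x => symmDeriv I φ x u) (w := fun x => symmDeriv I φ x v)
    (hφ.continuousOn_symmDeriv_section continuousOn_const)
    (hφ.continuousOn_symmDeriv_section continuousOn_const)

theorem continuousOn_sqrt_det_metricCoeff [IsManifold I ∞ M] (g : C0Metric I M)
    {φ : OpenPartialHomeomorph M E3} (hφ : IsCoordinateChart I φ) :
    ContinuousOn (fun x => Real.sqrt (metricCoeff g φ x).det) φ.target := by
  refine ContinuousOn.sqrt ?_
  have h : ∀ i j, ContinuousOn (fun x => metricCoeff g φ x i j) φ.target :=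
    fun i j => continuousOn_pullbackForm g hφ _ _
  simp only [Matrix.det_fin_three]
  fun_prop (disch := exact h _ _)

/-- A function of the coordinates `φ`, as a function on the manifold that vanishes outside the
domain of the coordinates. -/
noncomputable def chartPullback (φ : OpenPartialHomeomorph M E3) (u : E3 → ℝ) : M → ℝ :=
  φ.source.indicator (u ∘ φ)

theorem chartPullback_symm {φ : OpenPartialHomeomorph M E3} (u : E3 → ℝ) {x : E3}
    (hx : x ∈ φ.target) : chartPullback φ u (φ.symm x) = u x := by
  rw [chartPullback, indicator_of_mem (φ.map_target hx), Function.comp_apply, φ.right_inv hx]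

theorem isCompact_symm_image {φ : OpenPartialHomeomorph M E3} {C : Set E3} (hC : IsCompact C)
    (hCt : C ⊆ φ.target) : IsCompact (φ.symm '' C) :=
  hC.image_of_continuousOn (φ.continuousOn_symm.mono hCt)

/-- The image of `C` is compact, hence closed as `M` is Hausdorff; off `φ.source` the function
therefore vanishes on a neighbourhood. -/
theorem continuous_chartPullback [T2Space M] {φ : OpenPartialHomeomorph M E3} {u : E3 → ℝ}
    (hu : ContinuousOn u φ.target) {C : Set E3} (hC : IsCompact C) (hCt : C ⊆ φ.target)
    (h0 : ∀ x ∉ C, u x = 0) : Continuous (chartPullback φ u) := by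
  rw [continuous_iff_continuousAt]
  intro p
  by_cases hp : p ∈ φ.source
  · have h1 : ContinuousAt (u ∘ φ) p :=
      ((hu.continuousAt (φ.open_target.mem_nhds (φ.map_source hp)))).comp (φ.continuousAt hp)
    refine h1.congr ?_
    filter_upwards [φ.open_source.mem_nhds hp] with q hq
    rw [chartPullback, indicator_of_mem hq]
  · have hcl := (isCompact_symm_image hC hCt).isClosed
    have hpC : p ∉ φ.symm '' C := by
      rintro ⟨x, hx, rfl⟩; exact hp (φ.map_target (hCt hx))
    refine (continuousAt_const (y := (0 : ℝ))).congr ?_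
    filter_upwards [hcl.isOpen_compl.mem_nhds hpC] with q hq
    by_cases hqs : q ∈ φ.source
    · rw [chartPullback, indicator_of_mem hqs, Function.comp_apply, h0]
      exact fun h => hq ⟨φ q, h, φ.left_inv hqs⟩
    · rw [chartPullback, indicator_of_notMem hqs]

open Classical in
/-- The vector field with components `c` in the coordinates `φ`, extended by zero. -/
noncomputable def chartField (I : ModelWithCorners ℝ E3 H) (φ : OpenPartialHomeomorph M E3)
    (c : E3 → E3) (p : M) : TangentSpace I p :=
  if p ∈ φ.source then symmDeriv I φ (φ p) (c (φ p)) else (0 : E3)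

theorem chartField_of_mem {φ : OpenPartialHomeomorph M E3} (c : E3 → E3) {p : M}
    (hp : p ∈ φ.source) : chartField I φ c p = symmDeriv I φ (φ p) (c (φ p)) := if_pos hp

theorem chartField_of_notMem_image {φ : OpenPartialHomeomorph M E3} {c : E3 → E3}
    {C : Set E3} (h0 : ∀ x ∉ C, c x = 0) {p : M} (hp : p ∉ φ.symm '' C) :
    chartField I φ c p = 0 := by
  by_cases hps : p ∈ φ.source
  · rw [chartField_of_mem c hps, h0, map_zero]
    · rfl
    exact fun h => hp ⟨φ p, h, φ.left_inv hps⟩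
  · exact if_neg hps

theorem continuous_chartField [IsManifold I ∞ M] [T2Space M] {φ : OpenPartialHomeomorph M E3}
    (hφ : IsCoordinateChart I φ) {c : E3 → E3}
    (hc : ContinuousOn c φ.target) {C : Set E3} (hC : IsCompact C) (hCt : C ⊆ φ.target)
    (h0 : ∀ x ∉ C, c x = 0) :
    Continuous fun p : M => (⟨p, chartField I φ c p⟩ : TangentBundle I M) := by
  rw [continuous_iff_continuousAt]
  intro p
  by_cases hp : p ∈ φ.source
  · have h1 := ((hφ.continuousOn_symmDeriv_section hc).continuousAt
      (φ.open_target.mem_nhds (φ.map_source hp))).comp (φ.continuousAt hp)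
    refine h1.congr ?_
    filter_upwards [φ.open_source.mem_nhds hp] with q hq
    rw [chartField_of_mem c hq]
    exact congrArg (fun r : M => (⟨r, symmDeriv I φ (φ q) (c (φ q))⟩ : TangentBundle I M))
      (φ.left_inv hq)
  · have hcl := (isCompact_symm_image hC hCt).isClosed
    have hpC : p ∉ φ.symm '' C := by
      rintro ⟨x, hx, rfl⟩; exact hp (φ.map_target (hCt hx))
    refine (Bundle.Trivialization.continuous_zeroSection ℝ (F := E3)
      (E := fun x : M => TangentSpace I x)).continuousAt.congr ?_
    filter_upwards [hcl.isOpen_compl.mem_nhds hpC] with q hq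
    rw [chartField_of_notMem_image h0 hq]
    rfl

variable [IsManifold I ∞ M] [MeasurableSpace M] [BorelSpace M]

theorem setIntegral_chartPullback (g : C0Metric I M) {φ : OpenPartialHomeomorph M E3}
    (hφ : IsCoordinateChart I φ) {u : E3 → ℝ} (hu : ContinuousOn u φ.target) {A : Set M}
    (hA : MeasurableSet A) :
    ∫ p in A, chartPullback φ u p ∂(volumeMeasure g) =
      ∫ x in φ.target ∩ φ.symm ⁻¹' A, u x * Real.sqrt (metricCoeff g φ x).det := by
  have hS := φ.open_source.measurableSet
  have hT := φ.open_target.measurableSet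
  have hE := measurableSet_inter_preimage φ.continuousOn_symm hT hA
  have hae : AEMeasurable φ.symm (volume.restrict φ.target) := φ.continuousOn_symm.aemeasurable hT
  have hsq := continuousOn_sqrt_det_metricCoeff g hφ
  have h1 : ∫ p in A, chartPullback φ u p ∂(volumeMeasure g) =
      ∫ p, A.indicator (chartPullback φ u) p ∂(chartVolume g φ) := by
    rw [← integral_indicator hA, ← volumeMeasure_restrict_source g hφ,
      setIntegral_eq_integral_of_forall_compl_eq_zero]
    intro p hp
    by_cases hpA : p ∈ A
    · rw [indicator_of_mem hpA, chartPullback, indicator_of_notMem hp]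
    · rw [indicator_of_notMem hpA]
  have hmeas : AEStronglyMeasurable (A.indicator (chartPullback φ u)) (chartVolume g φ) := by
    have hco : ContinuousOn (u ∘ φ) φ.source := hu.comp φ.continuousOn φ.mapsTo
    exact ((aestronglyMeasurable_indicator_iff hS).2
      (hco.aemeasurable hS).aestronglyMeasurable).indicator hA
  rw [h1, chartVolume, integral_map (hae.mono_ac (withDensity_absolutelyContinuous _ _)) hmeas,
    integral_withDensity_eq_integral_toReal_smul₀
      ((hsq.aemeasurable hT).ennreal_ofReal) (by simp),
    ← integral_indicator hT, ← integral_indicator hE]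
  congr 1
  ext x
  by_cases hx : x ∈ φ.target
  · rw [indicator_of_mem hx, ENNReal.toReal_ofReal (Real.sqrt_nonneg _), smul_eq_mul]
    by_cases hxA : φ.symm x ∈ A
    · rw [indicator_of_mem hxA,
        indicator_of_mem (show x ∈ φ.target ∩ φ.symm ⁻¹' A from ⟨hx, hxA⟩),
        chartPullback_symm u hx, mul_comm]
    · rw [indicator_of_notMem hxA, indicator_of_notMem (fun h => hxA h.2), mul_zero]
  · rw [indicator_of_notMem hx, indicator_of_notMem (fun h => hx h.1)]

/-- The derivative of a function on `M` at `p`, with the tangent space of `M` identified with the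
model space. -/
noncomputable def scalarDeriv (I : ModelWithCorners ℝ E3 H) (η : M → ℝ) (p : M) : E3 →L[ℝ] ℝ :=
  mfderiv I 𝓘(ℝ, ℝ) η p

/-- Dividing by `√det g_ij` cancels the volume density, so the weak divergence identity reduces to
Euclidean integration by parts for `ψ` and the merely continuous metric is never differentiated. -/
theorem isPerimeterTest_chartField [T2Space M] (g : C0Metric I M)
    {φ : OpenPartialHomeomorph M E3}
    (hφ : IsCoordinateChart I φ) {ψ : E3 → ℝ} (hψ : ContDiff ℝ 1 ψ) (hψc : HasCompactSupport ψ)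
    (hψt : tsupport ψ ⊆ φ.target) (v : E3)
    (hle : ∀ x ∈ φ.target, (ψ x / Real.sqrt (metricCoeff g φ x).det) ^ 2 *
      pullbackForm g φ x v v ≤ 1) :
    IsPerimeterTest g (chartField I φ fun x => (ψ x / Real.sqrt (metricCoeff g φ x).det) • v)
      (chartPullback φ fun x => fderiv ℝ ψ x v / Real.sqrt (metricCoeff g φ x).det) := by
  have hsq := continuousOn_sqrt_det_metricCoeff g hφ
  have hsq0 : ∀ x ∈ φ.target, Real.sqrt (metricCoeff g φ x).det ≠ 0 := fun x hx =>
    (Real.sqrt_pos.2 (det_metricCoeff_pos g hφ hx)).ne'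
  have hd : Continuous fun x => fderiv ℝ ψ x v :=
    (hψ.continuous_fderiv one_ne_zero).clm_apply continuous_const
  have hc : ContinuousOn (fun x => (ψ x / Real.sqrt (metricCoeff g φ x).det) • v) φ.target :=
    (hψ.continuous.continuousOn.div hsq hsq0).smul continuousOn_const
  have hψ0 : ∀ x ∉ tsupport ψ, ψ x = 0 := fun x hx => image_eq_zero_of_notMem_tsupport hx
  have hc0 : ∀ x ∉ tsupport ψ, (ψ x / Real.sqrt (metricCoeff g φ x).det) • v = 0 :=
    fun x hx => by rw [hψ0 x hx, zero_div, zero_smul]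
  have hd0 : ∀ x ∉ tsupport ψ, fderiv ℝ ψ x = 0 := fun x hx =>
    image_eq_zero_of_notMem_tsupport fun h => hx (tsupport_fderiv_subset ℝ h)
  have hu : ContinuousOn (fun x => fderiv ℝ ψ x v / Real.sqrt (metricCoeff g φ x).det) φ.target :=
    hd.continuousOn.div hsq hsq0
  refine ⟨continuous_chartField hφ hc hψc hψt hc0, ⟨φ.symm '' tsupport ψ,
    isCompact_symm_image hψc hψt, ?_, fun p hp => chartField_of_notMem_image hc0 hp⟩, fun p => ?_,
    continuous_chartPullback hu hψc hψt fun x hx => by rw [hd0 x hx]; simp, fun η hη _ => ?_⟩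
  · rintro _ ⟨x, hx, rfl⟩
    exact hφ.source_subset_interior (φ.map_target (hψt hx))
  · by_cases hp : p ∈ φ.source
    · have := hle _ (φ.map_source hp)
      rw [pullbackForm, ContinuousLinearMap.bilinearComp_apply, φ.left_inv hp] at this
      rw [chartField_of_mem _ hp]
      refine le_trans (le_of_eq ?_) this
      change g.form p _ _ = _
      simp only [map_smul, smul_apply, smul_eq_mul]
      ring
    · have h0 : chartField I φ (fun x => (ψ x / Real.sqrt (metricCoeff g φ x).det) • v) p = 0 :=
        if_neg hp
      rw [h0]; simp
  · set η' : E3 → ℝ := η ∘ φ.symm with hη'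
    have hηs : ContDiffOn ℝ ∞ η' φ.target := (hη.comp_contMDiffOn hφ.2).contDiffOn
    have hηd : ∀ x ∈ φ.target, DifferentiableAt ℝ η' x := fun x hx =>
      (hηs.contDiffAt (φ.open_target.mem_nhds hx)).differentiableAt (by simp)
    have hηfd : ContinuousOn (fun x => fderiv ℝ η' x v) φ.target :=
      (hηs.continuousOn_fderiv_of_isOpen φ.open_target (by simp)).clm_apply continuousOn_const
    have hL : (fun p => (mfderiv I 𝓘(ℝ, ℝ) η p (chartField I φ
        (fun x => (ψ x / Real.sqrt (metricCoeff g φ x).det) • v) p) : ℝ)) =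
        chartPullback φ fun x => fderiv ℝ η' x v * ψ x / Real.sqrt (metricCoeff g φ x).det := by
      ext p
      by_cases hp : p ∈ φ.source
      · have hx := φ.map_source hp
        have hcomp : HasFDerivAt η' ((scalarDeriv I η p).comp
            (symmDeriv I φ (φ p))) (φ p) := by
          have hη1 : MDifferentiableAt I 𝓘(ℝ, ℝ) η (φ.symm (φ p)) :=
            hη.mdifferentiableAt (by simp)
          have := (hη1.hasMFDerivAt.comp (φ p)
            (hφ.mdifferentiableAt_symm hx).hasMFDerivAt).hasFDerivAt
          rw [φ.left_inv hp] at this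
          exact this
        rw [chartPullback, indicator_of_mem hp, Function.comp_apply, hcomp.fderiv,
          chartField_of_mem _ hp]
        change scalarDeriv I η p _ = _
        simp only [map_smul, smul_eq_mul, ContinuousLinearMap.comp_apply]
        ring
      · have h0 : chartField I φ (fun x => (ψ x / Real.sqrt (metricCoeff g φ x).det) • v) p = 0 :=
          if_neg hp
        rw [chartPullback, indicator_of_notMem hp, h0]
        exact map_zero _
    have hR : (fun p => η p * chartPullback φ
        (fun x => fderiv ℝ ψ x v / Real.sqrt (metricCoeff g φ x).det) p) =
        chartPullback φ fun x => η' x * fderiv ℝ ψ x v / Real.sqrt (metricCoeff g φ x).det := by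
      ext p
      by_cases hp : p ∈ φ.source
      · simp only [chartPullback, indicator_of_mem hp, Function.comp_apply, hη', φ.left_inv hp]
        ring
      · simp only [chartPullback, indicator_of_notMem hp, mul_zero]
    have hint : ∀ w : E3 → ℝ, ContinuousOn w φ.target → (∀ x ∉ tsupport ψ, w x = 0) →
        Integrable w ∧ ∫ p, chartPullback φ
          (fun x => w x / Real.sqrt (metricCoeff g φ x).det) p ∂(volumeMeasure g) = ∫ x, w x := by
      intro w hw hw0
      constructor
      · rw [← integrableOn_iff_integrable_of_support_subset
          (s := tsupport ψ) (fun x hx => by_contra fun h => hx (hw0 x h))]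
        exact (hw.mono hψt).integrableOn_compact hψc
      · have := setIntegral_chartPullback g hφ
          (u := fun x => w x / Real.sqrt (metricCoeff g φ x).det) (hw.div hsq hsq0) MeasurableSet.univ
        rw [Measure.restrict_univ, preimage_univ, inter_univ] at this
        rw [this, ← setIntegral_eq_integral_of_forall_compl_eq_zero (s := φ.target)
          (fun x hx => hw0 x fun h => hx (hψt h))]
        refine setIntegral_congr_fun φ.open_target.measurableSet fun x hx => ?_
        exact div_mul_cancel₀ _ (hsq0 x hx)
    have h1 := hint (fun x => fderiv ℝ η' x v * ψ x) (hηfd.mul hψ.continuous.continuousOn)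
      (fun x hx => by rw [hψ0 x hx, mul_zero])
    have h2 := hint (fun x => η' x * fderiv ℝ ψ x v) (hηs.continuousOn.mul hd.continuousOn)
      (fun x hx => by rw [hd0 x hx]; simp)
    have h3 := hint (fun x => η' x * ψ x) (hηs.continuousOn.mul hψ.continuous.continuousOn)
      (fun x hx => by rw [hψ0 x hx, mul_zero])
    rw [hL, hR, h1.2, h2.2, integral_mul_fderiv_eq_neg_fderiv_mul_of_integrable h1.1 h2.1 h3.1
      (fun x hx => hηd x (hψt hx)) (fun x _ => (hψ.differentiable one_ne_zero) x), neg_neg]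

theorem setIntegral_fderiv_nonpos_of_perimeter_eq_zero [T2Space M] (g : C0Metric I M)
    {φ : OpenPartialHomeomorph M E3}
    (hφ : IsCoordinateChart I φ) {K : Set M} (hK : MeasurableSet K) (hper : perimeter g K = 0)
    {ψ : E3 → ℝ} (hψ : ContDiff ℝ 1 ψ) (hψc : HasCompactSupport ψ)
    (hψt : tsupport ψ ⊆ φ.target) (v : E3) :
    ∫ x in φ.target ∩ φ.symm ⁻¹' K, fderiv ℝ ψ x v ≤ 0 := by
  have hsq := continuousOn_sqrt_det_metricCoeff g hφ
  have hsq0 : ∀ x ∈ φ.target, Real.sqrt (metricCoeff g φ x).det ≠ 0 := fun x hx =>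
    (Real.sqrt_pos.2 (det_metricCoeff_pos g hφ hx)).ne'
  have hcont : ContinuousOn (fun x => (ψ x / Real.sqrt (metricCoeff g φ x).det) ^ 2 *
      pullbackForm g φ x v v) φ.target :=
    ((hψ.continuous.continuousOn.div hsq hsq0).pow 2).mul (continuousOn_pullbackForm g hφ v v)
  obtain ⟨B, hB⟩ := (hψc.isCompact.image_of_continuousOn (hcont.mono hψt)).bddAbove
  -- Scaling by `b⁻¹` brings the squared length down to at most `b⁻¹ ^ 2 * b = b⁻¹ ≤ 1`.
  set b : ℝ := max B 1 with hb
  have hb1 : 1 ≤ b := le_max_right _ _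
  have hb0 : 0 < b := by linarith
  have hle : ∀ x ∈ φ.target, ((b⁻¹ * ψ x) / Real.sqrt (metricCoeff g φ x).det) ^ 2 *
      pullbackForm g φ x v v ≤ 1 := by
    intro x hx
    by_cases hxs : x ∈ tsupport ψ
    · have h1 : (ψ x / Real.sqrt (metricCoeff g φ x).det) ^ 2 * pullbackForm g φ x v v ≤ b :=
        (hB ⟨x, hxs, rfl⟩).trans (le_max_left _ _)
      have h2 : ((b⁻¹ * ψ x) / Real.sqrt (metricCoeff g φ x).det) ^ 2 * pullbackForm g φ x v v =
          b⁻¹ ^ 2 * ((ψ x / Real.sqrt (metricCoeff g φ x).det) ^ 2 * pullbackForm g φ x v v) := by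
        ring
      rw [h2]
      calc _ ≤ b⁻¹ ^ 2 * b := by gcongr
        _ = b⁻¹ := by field_simp
        _ ≤ 1 := inv_le_one_of_one_le₀ hb1
    · rw [image_eq_zero_of_notMem_tsupport hxs]; simp
  have hts : tsupport (fun x => b⁻¹ * ψ x) ⊆ tsupport ψ :=
    closure_mono fun x hx h0 => hx (by simp [h0])
  have htest := isPerimeterTest_chartField g hφ (contDiff_const.mul hψ) hψc.mul_left
    (hts.trans hψt) v hle
  have hzero := hper.le
  rw [perimeter] at hzero
  simp only [iSup_le_iff] at hzero
  have h1 := ENNReal.ofReal_eq_zero.1 (le_zero_iff.1 (hzero _ _ htest))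
  have hd : ∀ x, fderiv ℝ (fun x => b⁻¹ * ψ x) x v = b⁻¹ * fderiv ℝ ψ x v := fun x => by
    rw [fderiv_const_mul ((hψ.differentiable one_ne_zero) x)]; rfl
  have hdc : Continuous fun x => fderiv ℝ ψ x v :=
    (hψ.continuous_fderiv one_ne_zero).clm_apply continuous_const
  simp only [hd] at h1
  rw [setIntegral_chartPullback g hφ
    (u := fun x => b⁻¹ * fderiv ℝ ψ x v / Real.sqrt (metricCoeff g φ x).det)
    ((continuousOn_const.mul hdc.continuousOn).div hsq hsq0) hK,
    setIntegral_congr_fun (measurableSet_inter_preimage φ.continuousOn_symm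
      φ.open_target.measurableSet hK) (g := fun x => b⁻¹ * fderiv ℝ ψ x v)
      (fun x hx => div_mul_cancel₀ _ (hsq0 x hx.1)), integral_const_mul] at h1
  exact nonpos_of_mul_nonpos_right h1 (by positivity)

/-- The inequality for `v` and for `-v`: the indicator of `K` has vanishing distributional gradient
in the chart. -/
theorem setIntegral_fderiv_eq_zero_of_perimeter_eq_zero [T2Space M] (g : C0Metric I M)
    {φ : OpenPartialHomeomorph M E3}
    (hφ : IsCoordinateChart I φ) {K : Set M} (hK : MeasurableSet K) (hper : perimeter g K = 0)
    {ψ : E3 → ℝ} (hψ : ContDiff ℝ 1 ψ) (hψc : HasCompactSupport ψ)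
    (hψt : tsupport ψ ⊆ φ.target) (v : E3) :
    ∫ x in φ.target ∩ φ.symm ⁻¹' K, fderiv ℝ ψ x v = 0 := by
  refine le_antisymm (setIntegral_fderiv_nonpos_of_perimeter_eq_zero g hφ hK hper hψ hψc hψt v) ?_
  have := setIntegral_fderiv_nonpos_of_perimeter_eq_zero g hφ hK hper hψ hψc hψt (-v)
  simp only [map_neg, integral_neg] at this
  linarith

end

/-! ### Sets without perimeter in the exterior of a ball -/

section

theorem isPreconnected_compl_closedBall (c : E3) {R : ℝ} (hR : 0 ≤ R) :
    IsPreconnected (Metric.closedBall c R)ᶜ := by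
  have hrank : 1 < Module.rank ℝ E3 := by
    rw [← Module.finrank_eq_rank, finrank_euclideanSpace]; norm_num
  have h : (Metric.closedBall c R)ᶜ =
      (fun p : ℝ × E3 => c + p.1 • p.2) '' (Ioi R ×ˢ Metric.sphere (0 : E3) 1) := by
    ext x
    simp only [mem_compl_iff, Metric.mem_closedBall, not_le, mem_image, mem_prod, mem_Ioi,
      mem_sphere_zero_iff_norm, Prod.exists, dist_eq_norm]
    constructor
    · intro hx
      have hpos : 0 < ‖x - c‖ := hR.trans_lt hx
      refine ⟨‖x - c‖, ‖x - c‖⁻¹ • (x - c), ⟨hx, ?_⟩, ?_⟩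
      · rw [norm_smul, norm_inv, norm_norm, inv_mul_cancel₀ hpos.ne']
      · rw [smul_smul, mul_inv_cancel₀ hpos.ne', one_smul, add_sub_cancel]
    · rintro ⟨t, u, ⟨ht, hu⟩, rfl⟩
      rw [add_sub_cancel_left, norm_smul, hu, mul_one, Real.norm_eq_abs]
      exact ht.trans_le (le_abs_self t)
  rw [h]
  exact (isPreconnected_Ioi.prod (isPreconnected_sphere hrank 0 1)).image _ (by fun_prop)

/-- The mollification `G` of the indicator has zero gradient on the smaller exterior, so it is
constant there by connectedness. Finite volume makes it tend to 0 at infinity, so it vanishes, and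
positivity of the mollifier makes the set locally null. -/
theorem volume_inter_compl_closedBall_eq_zero {E : Set E3} (hE : MeasurableSet E) (c : E3) {R : ℝ}
    (hR : 0 ≤ R) (hfin : volume (E ∩ (Metric.closedBall c R)ᶜ) < ⊤)
    (hdiv : ∀ ψ : E3 → ℝ, ContDiff ℝ 1 ψ → HasCompactSupport ψ →
      tsupport ψ ⊆ (Metric.closedBall c R)ᶜ → ∀ v, ∫ x in E, fderiv ℝ ψ x v = 0) :
    volume (E ∩ (Metric.closedBall c (R + 1))ᶜ) = 0 := by
  set U := (Metric.closedBall c R)ᶜ with hU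
  set U' := (Metric.closedBall c (R + 1))ᶜ with hU'
  have hUm : MeasurableSet U := Metric.isClosed_closedBall.measurableSet.compl
  have hEU : MeasurableSet (E ∩ U) := hE.inter hUm
  -- Outer radius 1 matches the loss from `R` to `R + 1`: the bump centred at a point of `U'` is
  -- supported in `U`.
  let b : ContDiffBump (0 : E3) := ⟨1 / 2, 1, by norm_num, by norm_num⟩
  have hbs : ContDiff ℝ 1 b := b.contDiff
  have hbc : HasCompactSupport b := b.hasCompactSupport
  have : IsFiniteMeasure (volume.restrict (E ∩ U)) := ⟨by simpa using hfin⟩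
  obtain ⟨C, hC⟩ := (hbc.fderiv (𝕜 := ℝ)).exists_bound_of_continuous
    (hbs.continuous_fderiv one_ne_zero)
  have hfc : Continuous (fderiv ℝ b) := hbs.continuous_fderiv one_ne_zero
  set G : E3 → ℝ := fun a => ∫ x in E ∩ U, b (a - x) with hG
  have hint : ∀ a, Integrable (fun x => b (a - x)) (volume.restrict (E ∩ U)) := fun a =>
    Integrable.of_bound (C := 1)
      (hbs.continuous.comp (continuous_const.sub continuous_id)).aestronglyMeasurable
      (Eventually.of_forall fun x => by
        rw [Real.norm_eq_abs, abs_of_nonneg b.nonneg]; exact b.le_one)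
  have hint' : ∀ a, Integrable (fun x => fderiv ℝ b (a - x)) (volume.restrict (E ∩ U)) := fun a =>
    Integrable.of_bound (C := C)
      (hfc.comp (continuous_const.sub continuous_id)).aestronglyMeasurable
      (Eventually.of_forall fun x => hC _)
  have hGd : ∀ a, HasFDerivAt G (∫ x in E ∩ U, fderiv ℝ b (a - x)) a := fun a =>
    hasFDerivAt_integral_of_dominated_of_fderiv_le (s := univ) (F := fun y x => b (y - x))
      (F' := fun y x => fderiv ℝ b (y - x)) (bound := fun _ => C) univ_mem
      (Eventually.of_forall fun y => (hint y).aestronglyMeasurable) (hint a)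
      (hint' a).aestronglyMeasurable (Eventually.of_forall fun x y _ => hC _)
      (integrable_const _) (Eventually.of_forall fun x y _ => by
        have h1 := ((hbs.differentiable one_ne_zero) (y - x)).hasFDerivAt
        simpa [Function.comp_def] using h1.comp y ((hasFDerivAt_id y).sub_const x))
  have hG0 : ∀ a ∈ U', fderiv ℝ G a = 0 := by
    intro a ha
    rw [(hGd a).fderiv]
    ext v
    rw [ContinuousLinearMap.integral_apply (hint' a)]
    have hts : tsupport (fun x => b (a - x)) ⊆ Metric.closedBall a 1 := by
      refine closure_minimal (fun x hx => ?_) Metric.isClosed_closedBall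
      have : a - x ∈ Function.support b := hx
      rw [b.support_eq, mem_ball_zero_iff, ← dist_eq_norm, dist_comm] at this
      exact this.le
    have htU : tsupport (fun x => b (a - x)) ⊆ U := by
      intro x hx
      have h1 := hts hx
      simp only [hU, hU', mem_compl_iff, Metric.mem_closedBall, not_le] at ha h1 ⊢
      have := dist_triangle_left a c x
      linarith
    have hcd : ContDiff ℝ 1 (fun x => b (a - x)) := hbs.comp (contDiff_const.sub contDiff_id)
    have hd : ∀ x, fderiv ℝ (fun x => b (a - x)) x v = - fderiv ℝ b (a - x) v := by
      intro x
      have h1 := ((hbs.differentiable one_ne_zero) (a - x)).hasFDerivAt.comp x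
        ((hasFDerivAt_id x).const_sub a)
      have h2 : fderiv ℝ (fun x => b (a - x)) x = _ := h1.fderiv
      rw [h2]; simp
    have h0 := hdiv _ hcd
      (HasCompactSupport.of_support_subset_isCompact (isCompact_closedBall a 1)
        (subset_closure.trans hts)) htU v
    -- `hdiv` integrates over `E`, but only `E ∩ U` is known to have finite measure; the integrand
    -- vanishes off `U`.
    rw [setIntegral_eq_of_subset_of_forall_sdiff_eq_zero hE inter_subset_left (s := E ∩ U)] at h0
    · simp only [hd, integral_neg, neg_eq_zero] at h0
      exact h0
    · intro x hx
      have : x ∉ tsupport (fun x => b (a - x)) := fun h => hx.2 ⟨hx.1, htU h⟩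
      have : fderiv ℝ (fun x => b (a - x)) x = 0 :=
        image_eq_zero_of_notMem_tsupport fun h => this (tsupport_fderiv_subset ℝ h)
      rw [this]; rfl
  have hU'o : IsOpen U' := Metric.isClosed_closedBall.isOpen_compl
  have hconst : ∀ a ∈ U', ∀ a' ∈ U', G a = G a' := fun a ha a' ha' =>
    hU'o.is_const_of_fderiv_eq_zero (isPreconnected_compl_closedBall c (by linarith))
      (fun y _ => (hGd y).differentiableAt.differentiableWithinAt) hG0 ha ha'
  set e : E3 := EuclideanSpace.single 0 1 with he
  set s : ℕ → E3 := fun n => (n : ℝ) • e with hs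
  have hen : ‖e‖ = 1 := by simp [he]
  have hdist : ∀ x : E3, Tendsto (fun n => dist (s n) x) atTop atTop := by
    intro x
    refine tendsto_atTop_mono (f := fun n : ℕ => (n : ℝ) - ‖x‖) (fun n => ?_)
      (tendsto_atTop_add_const_right _ _ tendsto_natCast_atTop_atTop)
    have h1 : ‖s n‖ = n := by simp [hs, norm_smul, hen]
    rw [dist_eq_norm, ← h1]
    exact norm_sub_norm_le _ _
  have hlim : Tendsto (fun n => G (s n)) atTop (𝓝 0) := by
    have := tendsto_integral_of_dominated_convergence (μ := volume.restrict (E ∩ U))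
      (F := fun n x => b (s n - x)) (f := fun _ => (0 : ℝ)) (fun _ => (1 : ℝ))
      (fun n => (hint (s n)).aestronglyMeasurable) (integrable_const _)
      (fun n => Eventually.of_forall fun x => by
        rw [Real.norm_eq_abs, abs_of_nonneg b.nonneg]; exact b.le_one)
      (Eventually.of_forall fun x => by
        refine tendsto_const_nhds.congr' ?_
        filter_upwards [(hdist x).eventually_ge_atTop 1] with n hn
        exact (b.zero_of_le_dist (by simpa [dist_eq_norm] using hn)).symm)
    simpa using this
  have hzero : ∀ a ∈ U', G a = 0 := by
    intro a ha
    refine tendsto_nhds_unique (tendsto_const_nhds.congr' ?_) hlim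
    filter_upwards [(hdist c).eventually_gt_atTop (R + 1)] with n hn
    exact hconst a ha _ (by simpa [hU'] using hn)
  refine measure_null_of_locally_null _ fun a ha => ⟨E ∩ U' ∩ Metric.ball a 1,
    inter_mem_nhdsWithin _ (Metric.ball_mem_nhds a one_pos), ?_⟩
  have h1 := (integral_eq_zero_iff_of_nonneg (fun x => b.nonneg) (hint a)).1 (hzero a ha.2)
  have h2 : ∀ᵐ x ∂volume, x ∈ E ∩ U → b (a - x) = 0 := (ae_restrict_iff' hEU).1 h1
  refine measure_mono_null (t := {x | ¬(x ∈ E ∩ U → b (a - x) = 0)}) (fun x hx hx0 => ?_)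
    (ae_iff.1 h2)
  have hxU : x ∈ U := fun h => hx.1.2
    (Metric.closedBall_subset_closedBall (by linarith) h)
  have h3 := hx0 ⟨hx.1.1, hxU⟩
  refine (b.pos_of_mem_ball (x := a - x) ?_).ne' h3
  rw [mem_ball_zero_iff, ← dist_eq_norm, dist_comm]
  exact hx.2

end

/-! ### The asymptotically flat end -/

section

variable {H : Type*} [TopologicalSpace H] {I : ModelWithCorners ℝ E3 H}
  {M : Type*} [TopologicalSpace M] [ChartedSpace H M] [IsManifold I ∞ M]

theorem exists_half_le_sqrt_det_metricCoeff (g : C0Metric I M) (φ : OpenPartialHomeomorph M E3)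
    {q : ℝ} (hq : 0 < q) (c : E3) (R : ℝ)
    (h : ∀ i j : Fin 3,
      (fun x : E3 => metricCoeff g φ x i j - (1 : Matrix (Fin 3) (Fin 3) ℝ) i j)
        =O[Bornology.cobounded E3] fun x : E3 => ‖x‖ ^ (-q)) :
    ∃ R' : ℝ, R ≤ R' ∧ ∀ x ∈ (Metric.closedBall c R')ᶜ,
      1 / 2 ≤ Real.sqrt (metricCoeff g φ x).det := by
  have hent : ∀ i j, Tendsto (fun x => metricCoeff g φ x i j) (Bornology.cobounded E3)
      (𝓝 ((1 : Matrix (Fin 3) (Fin 3) ℝ) i j)) := fun i j => by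
    have h0 := (h i j).trans_tendsto
      ((tendsto_rpow_neg_atTop hq).comp tendsto_norm_cobounded_atTop)
    simpa using h0.add_const ((1 : Matrix (Fin 3) (Fin 3) ℝ) i j)
  have hmat : Tendsto (metricCoeff g φ) (Bornology.cobounded E3) (𝓝 1) :=
    tendsto_pi_nhds.2 fun i => tendsto_pi_nhds.2 fun j => hent i j
  have hcont : Continuous fun A : Matrix (Fin 3) (Fin 3) ℝ => Real.sqrt A.det :=
    (continuous_id.matrix_det).sqrt
  have hlim := (hcont.tendsto 1).comp hmat
  have hev := hlim.eventually_const_le (u := 1 / 2) (by norm_num)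
  obtain ⟨r, -, hr⟩ := (Metric.hasBasis_cobounded_compl_closedBall c).eventually_iff.1 hev
  refine ⟨max R r, le_max_left _ _, fun x hx => hr fun hxr => hx ?_⟩
  exact Metric.closedBall_subset_closedBall (le_max_right _ _) hxr

variable [MeasurableSpace M] [BorelSpace M]

/-- This serves in two directions: finite `g`-volume of `K j` gives finite Lebesgue measure on the
end, and infinite Lebesgue measure of the end gives infinite `g`-volume of `M`. -/
theorem volume_le_two_mul_volumeMeasure (g : C0Metric I M) {φ : OpenPartialHomeomorph M E3}
    (hφ : IsCoordinateChart I φ) {U : Set E3} (hU : MeasurableSet U)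
    (hhalf : ∀ x ∈ U, 1 / 2 ≤ Real.sqrt (metricCoeff g φ x).det)
    {A : Set M} (hA : MeasurableSet A) :
    volume (φ.target ∩ φ.symm ⁻¹' A ∩ U) ≤ 2 * volumeMeasure g A := by
  have hE := (measurableSet_inter_preimage φ.continuousOn_symm φ.open_target.measurableSet
    hA).inter hU
  calc volume (φ.target ∩ φ.symm ⁻¹' A ∩ U)
      = ∫⁻ _ in φ.target ∩ φ.symm ⁻¹' A ∩ U, 1 := by simp
    _ ≤ ∫⁻ x in φ.target ∩ φ.symm ⁻¹' A ∩ U,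
          2 * ENNReal.ofReal (Real.sqrt (metricCoeff g φ x).det) := by
        refine setLIntegral_mono' hE fun x hx => ?_
        rw [← ENNReal.ofReal_ofNat, ← ENNReal.ofReal_mul zero_le_two, ← ENNReal.ofReal_one]
        exact ENNReal.ofReal_le_ofReal (by linarith [hhalf x hx.2])
    _ ≤ ∫⁻ x in φ.target ∩ φ.symm ⁻¹' A,
          2 * ENNReal.ofReal (Real.sqrt (metricCoeff g φ x).det) :=
        lintegral_mono_set inter_subset_left
    _ = 2 * chartVolume g φ A := by
        rw [lintegral_const_mul' _ _ (by simp), chartVolume_apply g φ hA]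
    _ ≤ 2 * volumeMeasure g A := by
        gcongr
        rw [← volumeMeasure_restrict_source g hφ]
        exact Measure.restrict_le_self

theorem volume_compl_closedBall (c : E3) (R : ℝ) : volume (Metric.closedBall c R)ᶜ = ⊤ := by
  have h : volume (univ : Set E3) = ⊤ := measure_univ_of_isAddLeftInvariant _
  rw [measure_compl Metric.isClosed_closedBall.measurableSet measure_closedBall_lt_top.ne, h,
    ENNReal.top_sub measure_closedBall_lt_top.ne]

theorem eventually_perimeter_ne_zero_and_tendsto [T2Space M] (g : C0Metric I M)
    (hg : IsC0AsymptoticallyFlat g) (K : CompactExhaustion M) :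
    (∀ᶠ j in atTop, perimeter g (K j) ≠ 0) ∧
      Tendsto (fun j => (volumeMeasure g (K j)).toReal) atTop atTop := by
  obtain ⟨-, φ, c, R, q, -, hR, hq, hφ, -, htgt, hO⟩ := hg
  obtain ⟨R', hRR', hhalf⟩ := exists_half_le_sqrt_det_metricCoeff g φ hq c R hO
  set U := (Metric.closedBall c R')ᶜ with hU
  have hUm : MeasurableSet U := Metric.isClosed_closedBall.measurableSet.compl
  have hUt : U ⊆ φ.target := by
    rw [htgt]; exact compl_subset_compl.2 (Metric.closedBall_subset_closedBall hRR')
  have hKm : ∀ j, MeasurableSet (K j) := fun j => (K.isCompact j).measurableSet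
  have hKfin : ∀ j, volumeMeasure g (K j) < ⊤ := fun j => (K.isCompact j).measure_lt_top
  set E : ℕ → Set E3 := fun j => φ.target ∩ φ.symm ⁻¹' (K j) with hE
  have hEm : ∀ j, MeasurableSet (E j) := fun j =>
    measurableSet_inter_preimage φ.continuousOn_symm φ.open_target.measurableSet (hKm j)
  have hmono : Monotone K := fun i j hij => K.subset hij
  constructor
  · set U' := (Metric.closedBall c (R' + 1))ᶜ with hU'
    have hU'U : U' ⊆ U :=
      compl_subset_compl.2 (Metric.closedBall_subset_closedBall (by linarith))
    -- The sets `E j` cover `U'`, which has infinite measure, so they cannot all be null in it; by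
    -- monotonicity every later index works too.
    obtain ⟨j₀, hj₀⟩ : ∃ j, volume (E j ∩ U') ≠ 0 := by
      by_contra! hall
      have h0 := measure_iUnion_null hall
      have h1 : U' ⊆ ⋃ j, E j ∩ U' := fun x hx => by
        obtain ⟨j, hj⟩ := mem_iUnion.1 (K.iUnion_eq.symm ▸ mem_univ (φ.symm x))
        exact mem_iUnion.2 ⟨j, ⟨hUt (hU'U hx), hj⟩, hx⟩
      have h2 := measure_mono_null h1 h0
      rw [hU', volume_compl_closedBall] at h2
      exact ENNReal.top_ne_zero h2
    filter_upwards [eventually_ge_atTop j₀] with j hj hper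
    have hsub : E j₀ ∩ U' ⊆ E j ∩ U' := fun x hx => ⟨⟨hx.1.1, hmono hj hx.1.2⟩, hx.2⟩
    refine hj₀ (measure_mono_null hsub
      (volume_inter_compl_closedBall_eq_zero (hEm j) c (by linarith) ?_ ?_))
    · exact (volume_le_two_mul_volumeMeasure g hφ hUm hhalf (hKm j)).trans_lt
        (ENNReal.mul_lt_top (by simp) (hKfin j))
    · exact fun ψ hψ hψc hψt v =>
        setIntegral_fderiv_eq_zero_of_perimeter_eq_zero g hφ (hKm j) hper hψ hψc (hψt.trans hUt) v
  · have htop : volumeMeasure g univ = ⊤ := by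
      have h := volume_le_two_mul_volumeMeasure g hφ hUm hhalf MeasurableSet.univ
      rw [preimage_univ, inter_univ, inter_eq_self_of_subset_right hUt, hU,
        volume_compl_closedBall, top_le_iff] at h
      by_contra hne
      exact ENNReal.mul_ne_top (by simp) hne h
    have hlim := tendsto_measure_iUnion_atTop (μ := volumeMeasure g) hmono
    rw [K.iUnion_eq, htop] at hlim
    refine tendsto_atTop.2 fun b => ?_
    filter_upwards [hlim.eventually (lt_mem_nhds (ENNReal.ofReal_lt_top (r := b)))] with j hj
    exact (ENNReal.ofReal_le_iff_le_toReal (hKfin j).ne).1 hj.le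

end

end IsoMass

theorem mainTheorem12 {H : Type*} [TopologicalSpace H]
    (I : ModelWithCorners ℝ (EuclideanSpace ℝ (Fin 3)) H)
    {M : Type*} [TopologicalSpace M] [ChartedSpace H M] [IsManifold I ∞ M]
    [T2Space M] [SecondCountableTopology M] [MeasurableSpace M] [BorelSpace M]
    (g : IsoMass.C0Metric I M) (hg : IsoMass.IsC0AsymptoticallyFlat g) :
    IsoMass.isoperimetricMass g =
      2 * ⨆ K : CompactExhaustion M,
        limsup (fun j : ℕ => IsoMass.radiusDifference g (K j)) atTop := by
  rw [IsoMass.two_mul_iSup]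
  refine iSup_congr fun K => ?_
  obtain ⟨hper, hvol⟩ := IsoMass.eventually_perimeter_ne_zero_and_tendsto g hg K
  exact IsoMass.limsup_deficit_eq_two_mul_limsup hvol hper
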